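/- Let $q\geq 4$, let $Q=\{1,\dots,q\}$, and let $H(q,q)$ be the Hamming graph whose vertices are the $q$-tuples over $Q$, two being adjacent when they differ in exactly one entry. For a code (set of vertices) $C$, let $\Gamma_1(C)$ be the set of vertices not in $C$ that are adjacent to some element of $C$, and let the minimum distance of $C$ be the least Hamming distance between distinct elements of $C$. For $X\leq \mathrm{Aut}(H(q,q))$, the pair $(C,X)$ is called an elusive pair with parameters $(q,q,\delta)$ if $C$ has minimum distance $\delta$ and $X$ fixes $\Gamma_1(C)$ setwise but does not fix $C$ setwise. Let $$C=\{(1^g,2^g,\dots,q^g)\mid g\in A_q\}\ \cup\ \{(a,a,\dots,a)\mid a\in Q\},$$ and let $X=\mathrm{Diag}_q(S_q)\rtimes L\leq \mathrm{Aut}(H(q,q))$, where $\mathrm{Diag}_q(S_q)=\{x_y\mid y\in S_q\}$, $x_y$ maps $(\alpha_1,\dots,\alpha_q)$ to $(\alpha_1^y,\dots,\alpha_q^y)$, and $L\cong S_q$ is the group of all permutations of the $q$ coordinate positions. Then: 1. $(C,X)$ is an elusive pair with parameters $(q,q,3)$; 2. $X$ is not transitive on $\Gamma_1(C)$; 3.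 if $q\geq 5$, then $X$ is the full setwise stabiliser of $\Gamma_1(C)$ in $\mathrm{Aut}(H(q,q))$. -/

import Mathlib

open scoped Pointwise

namespace ElusiveCode

/-- The Hamming graph `H(m,q)` on `m`-tuples over an alphabet of size `q`: two tuples are adjacent
when they differ in exactly one position. -/
def hammingGraph (m q : ℕ) : SimpleGraph (Fin m → Fin q) where
  Adj α β := hammingDist α β = 1
  symm := ⟨fun α β h => by rwa [hammingDist_comm]⟩
  loopless := ⟨fun α h => by simp at h⟩

/-- `Aut(H(m,q))`, the group of all graph automorphisms (product = composition). It acts on vertices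
by application, hence on sets of vertices pointwise. -/
abbrev HammingAut (m q : ℕ) : Type := hammingGraph m q ≃g hammingGraph m q

/-- The set `Γ₁(C)` of neighbours of the code `C`: vertices outside `C` adjacent to an element
of `C`. -/
def neighbourSet {m q : ℕ} (C : Set (Fin m → Fin q)) : Set (Fin m → Fin q) :=
  {ν | ν ∉ C ∧ ∃ α ∈ C, (hammingGraph m q).Adj α ν}

/-- `δ` is the minimum distance of the code `C`: the least distance between distinct codewords. -/
def HasMinDist {m q : ℕ} (C : Set (Fin m → Fin q)) (δ : ℕ) : Prop :=
  IsLeast {d | ∃ α ∈ C, ∃ β ∈ C, α ≠ β ∧ hammingDist α β = d} δ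

/-- `(C, X)` is an elusive pair with parameters `(m, q, δ)`: `C` has minimum distance `δ`, and `X`
fixes `Γ₁(C)` setwise but does not fix `C` setwise. -/
def IsElusivePair {m q : ℕ} (δ : ℕ) (C : Set (Fin m → Fin q)) (X : Subgroup (HammingAut m q)) :
    Prop :=
  HasMinDist C δ ∧ (∀ x ∈ X, x • neighbourSet C = neighbourSet C) ∧ ¬ ∀ x ∈ X, x • C = C

/-- `X` acts transitively on `S` (any two points of `S` are related by an element of `X`). -/
def TransitiveOn {m q : ℕ} (X : Subgroup (HammingAut m q)) (S : Set (Fin m → Fin q)) : Prop :=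
  ∀ μ ∈ S, ∀ ν ∈ S, ∃ x ∈ X, x • μ = ν

/-- `y ↦ x_y = (y, …, y)`, the permutation `y` of the alphabet applied in every entry. -/
def diagHom (m q : ℕ) : Equiv.Perm (Fin q) →* HammingAut m q where
  toFun y :=
    { toEquiv := Equiv.arrowCongr (Equiv.refl (Fin m)) y
      map_rel_iff' := by
        intro α β
        have h : hammingDist (fun i => y (α i)) (fun i => y (β i)) = hammingDist α β :=
          hammingDist_comp (fun _ => y) (fun _ => y.injective)
        exact Eq.congr_left h }
  map_one' := rfl
  map_mul' _ _ := rfl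

/-- `σ` permuting the `m` entries: the `i`-th entry of the image of `α` is the `σ⁻¹ i`-th entry
of `α`. -/
def topHom (m q : ℕ) : Equiv.Perm (Fin m) →* HammingAut m q where
  toFun σ :=
    { toEquiv := Equiv.arrowCongr σ (Equiv.refl (Fin q))
      map_rel_iff' := by
        intro α β
        have h : hammingDist (fun i => α (σ⁻¹ i)) (fun i => β (σ⁻¹ i)) = hammingDist α β := by
          unfold hammingDist
          exact Finset.card_equiv σ⁻¹ (by simp)
        exact Eq.congr_left h }
  map_one' := rfl
  map_mul' _ _ := rfl

theorem diagHom_apply {m q : ℕ} (y : Equiv.Perm (Fin q)) (α : Fin m → Fin q) (i : Fin m) :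
    diagHom m q y α i = y (α i) := rfl

theorem topHom_apply {m q : ℕ} (σ : Equiv.Perm (Fin m)) (α : Fin m → Fin q) (i : Fin m) :
    topHom m q σ α i = α (σ⁻¹ i) := rfl

/-- `Diag_m(S_q) = {x_y | y ∈ S_q}`. -/
def diagGroup (m q : ℕ) : Subgroup (HammingAut m q) := (diagHom m q).range

/-- The top group `L ≅ S_m`, permuting the entries. -/
def topGroup (m q : ℕ) : Subgroup (HammingAut m q) := (topHom m q).range

/-- The subgroup `Diag_m(S_q) ⋊ L` of `Aut(H(m,q))`, that is, the subgroup generated by `Diag_m(S_q)`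
and `L`; the next three lemmas show that it is their (internal) semidirect product. -/
def diagTopGroup (m q : ℕ) : Subgroup (HammingAut m q) := diagGroup m q ⊔ topGroup m q

theorem diagHom_mul_topHom_comm {m q : ℕ} (y : Equiv.Perm (Fin q)) (σ : Equiv.Perm (Fin m)) :
    diagHom m q y * topHom m q σ = topHom m q σ * diagHom m q y := rfl

theorem mem_diagTopGroup {m q : ℕ} (x : HammingAut m q) :
    x ∈ diagTopGroup m q ↔
      ∃ (y : Equiv.Perm (Fin q)) (σ : Equiv.Perm (Fin m)), x = diagHom m q y * topHom m q σ := by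
  constructor
  · intro hx
    let K : Subgroup (HammingAut m q) :=
      { carrier := {x | ∃ (y : Equiv.Perm (Fin q)) (σ : Equiv.Perm (Fin m)),
          x = diagHom m q y * topHom m q σ}
        one_mem' := ⟨1, 1, rfl⟩
        mul_mem' := by
          rintro _ _ ⟨y, σ, rfl⟩ ⟨y', σ', rfl⟩
          exact ⟨y * y', σ * σ', rfl⟩
        inv_mem' := by
          rintro _ ⟨y, σ, rfl⟩
          exact ⟨y⁻¹, σ⁻¹, by rw [mul_inv_rev, map_inv, map_inv]; rfl⟩ }
    have h : diagTopGroup m q ≤ K := sup_le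
      (by rintro _ ⟨y, rfl⟩; exact ⟨y, 1, rfl⟩) (by rintro _ ⟨σ, rfl⟩; exact ⟨1, σ, rfl⟩)
    exact h hx
  · rintro ⟨y, σ, rfl⟩
    exact mul_mem (Subgroup.mem_sup_left ⟨y, rfl⟩) (Subgroup.mem_sup_right ⟨σ, rfl⟩)

theorem disjoint_diagGroup_topGroup {m q : ℕ} (hm : 0 < m) :
    Disjoint (diagGroup m q) (topGroup m q) := by
  rw [Subgroup.disjoint_def]
  rintro _ ⟨y, rfl⟩ ⟨σ, hσ⟩
  have hy : y = 1 := by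
    ext a
    have h := congrFun (DFunLike.congr_fun hσ (fun _ => a)) ⟨0, hm⟩
    rw [topHom_apply, diagHom_apply] at h
    simp [← h]
  rw [hy, map_one]

/-- The vertex `α(g) = (1^g, …, q^g)` of `H(q,q)`. -/
def permVertex {q : ℕ} (g : Equiv.Perm (Fin q)) : Fin q → Fin q := fun i => g i

/-- The permutation code `C(T) = {α(g) | g ∈ T}` in `H(q,q)`. -/
def permCode {q : ℕ} (T : Set (Equiv.Perm (Fin q))) : Set (Fin q → Fin q) := permVertex '' T

/-- The repetition code `Rep(m,q)` of all constant tuples in `H(m,q)`. -/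
def repCode (m q : ℕ) : Set (Fin m → Fin q) := Set.range fun a : Fin q => fun _ : Fin m => a

/-- The code `C(A_q) ∪ Rep(q,q)` in `H(q,q)`. -/
def altRepCode (q : ℕ) : Set (Fin q → Fin q) :=
  permCode (alternatingGroup (Fin q) : Set (Equiv.Perm (Fin q))) ∪ repCode q q

end ElusiveCode

namespace ElusiveCode

/-! The proof rests on describing `Γ₁(C)` without parity: it consists of the words with exactly one
coincidence (`IsPair`) and the constants altered in one entry (`IsSpike`). Each pair word is
adjacent to permutation vertices of both parities, so `A_q` gives the same neighbours as `S_q`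
would. The description is invariant under `X`, whereas an odd `x_y` moves `α(1)` out of `C`. Both
types occur, are disjoint and are preserved by `X`, so `X` is intransitive.

For `q ≥ 5`, adjacency inside `Γ₁(C)` distinguishes spikes from pair words (`isSpike_iff`), and
constants are recovered as the words all of whose neighbours are spikes. Hence a stabilising
automorphism permutes the constants. After correction by a diagonal element it fixes each of them,
and distances to constants and spikes then force it to be a permutation of the entries
(`mem_topGroup_of_fixes_const`). -/

theorem exists_fin_notMem {q : ℕ} (s : Finset (Fin q)) (h : s.card < q) : ∃ k, k ∉ s := by
  by_contra! hs
  have : s = Finset.univ := Finset.eq_univ_iff_forall.2 hs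
  simp [this] at h

theorem exists_ne_ne {q : ℕ} (hq : 3 ≤ q) (a b : Fin q) : ∃ k, k ≠ a ∧ k ≠ b := by
  obtain ⟨k, hk⟩ := exists_fin_notMem {a, b} (Finset.card_le_two.trans_lt hq)
  exact ⟨k, by simpa [not_or] using hk⟩

theorem exists_ne_ne_ne {q : ℕ} (hq : 4 ≤ q) (a b c : Fin q) : ∃ k, k ≠ a ∧ k ≠ b ∧ k ≠ c := by
  obtain ⟨k, hk⟩ := exists_fin_notMem {a, b, c} (Finset.card_le_three.trans_lt hq)
  exact ⟨k, by simpa [not_or] using hk⟩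

theorem exists_ne_ne_ne_ne {q : ℕ} (hq : 5 ≤ q) (a b c d : Fin q) :
    ∃ k, k ≠ a ∧ k ≠ b ∧ k ≠ c ∧ k ≠ d := by
  obtain ⟨k, hk⟩ := exists_fin_notMem {a, b, c, d} (Finset.card_le_four.trans_lt hq)
  exact ⟨k, by simpa [not_or] using hk⟩

/-! ### Distances in the Hamming graph -/

theorem adj_iff_exists_update {m q : ℕ} {α β : Fin m → Fin q} :
    (hammingGraph m q).Adj α β ↔ ∃ i c, c ≠ α i ∧ β = Function.update α i c := by
  change hammingDist α β = 1 ↔ _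
  unfold hammingDist
  rw [Finset.card_eq_one]
  constructor
  · rintro ⟨i, hi⟩
    simp only [Finset.ext_iff, Finset.mem_filter, Finset.mem_univ, true_and,
      Finset.mem_singleton] at hi
    refine ⟨i, β i, fun h => (hi i).2 rfl h.symm, ?_⟩
    ext1 j
    by_cases hj : j = i
    · subst hj; simp
    · rw [Function.update_of_ne hj]
      by_contra h
      exact hj ((hi j).1 (Ne.symm h))
  · rintro ⟨i, c, hc, rfl⟩
    refine ⟨i, ?_⟩
    ext j
    by_cases hj : j = i
    · subst hj; simpa using hc.symm
    · simp [hj]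

theorem adj_update {m q : ℕ} {α : Fin m → Fin q} {i : Fin m} {c : Fin q} (h : c ≠ α i) :
    (hammingGraph m q).Adj α (Function.update α i c) :=
  adj_iff_exists_update.2 ⟨i, c, h, rfl⟩

theorem not_adj_of_ne_of_ne {m q : ℕ} {α β : Fin m → Fin q} {i j : Fin m} (hij : i ≠ j)
    (hi : α i ≠ β i) (hj : α j ≠ β j) : ¬ (hammingGraph m q).Adj α β := by
  rw [adj_iff_exists_update]
  rintro ⟨k, c, -, rfl⟩
  have h1 : i = k := by by_contra h; simp [h] at hi
  have h2 : j = k := by by_contra h; simp [h] at hj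
  exact hij (h1.trans h2.symm)

theorem hammingDist_update_of_eq {m q : ℕ} {v w : Fin m → Fin q} {i : Fin m} {b : Fin q}
    (h : v i = w i) (hb : b ≠ v i) :
    hammingDist v (Function.update w i b) = hammingDist v w + 1 := by
  unfold hammingDist
  rw [← Finset.card_insert_of_notMem (a := i) (by simp [h])]
  congr 1
  ext j
  by_cases hj : j = i
  · subst hj; simpa using hb.symm
  · simp [hj]

theorem hammingDist_update_le_of_ne {m q : ℕ} {v w : Fin m → Fin q} {i : Fin m} {b : Fin q}
    (h : v i ≠ w i) : hammingDist v (Function.update w i b) ≤ hammingDist v w := by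
  unfold hammingDist
  refine Finset.card_le_card fun j => ?_
  by_cases hj : j = i
  · subst hj; simp [h]
  · simp [hj]

/-- Hamming distance is the path metric: resetting one differing entry of `β` to that of `α` is a
step along a geodesic. -/
theorem hammingDist_le_of_adj_preserving {m q : ℕ} {f : (Fin m → Fin q) → Fin m → Fin q}
    (hf : ∀ α β, (hammingGraph m q).Adj α β → (hammingGraph m q).Adj (f α) (f β))
    (α β : Fin m → Fin q) : hammingDist (f α) (f β) ≤ hammingDist α β := by
  induction hn : hammingDist α β generalizing β with
  | zero => simp [hammingDist_eq_zero.1 hn]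
  | succ n ih =>
    have hne : α ≠ β := by
      rintro rfl
      simp at hn
    obtain ⟨i, hi⟩ := Function.ne_iff.1 hne
    have hβ : Function.update (Function.update β i (α i)) i (β i) = β := by simp
    have h1 := hammingDist_update_of_eq (v := α) (w := Function.update β i (α i)) (i := i)
      (b := β i) (by simp) hi.symm
    rw [hβ, hn] at h1
    have h2 := ih (Function.update β i (α i)) (by omega)
    have h3 : hammingDist (f (Function.update β i (α i))) (f β) = 1 :=
      hf _ _ (adj_update hi).symm
    have := hammingDist_triangle (f α) (f (Function.update β i (α i))) (f β)
    omega

theorem hammingDist_map {m q : ℕ} (x : HammingAut m q) (α β : Fin m → Fin q) :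
    hammingDist (x α) (x β) = hammingDist α β := by
  refine le_antisymm (hammingDist_le_of_adj_preserving (fun _ _ => x.map_rel_iff.2) α β) ?_
  simpa using hammingDist_le_of_adj_preserving (f := x.symm)
    (fun _ _ => x.symm.map_rel_iff.2) (x α) (x β)

/-! ### Neighbours of the code -/

/-- The word `v` takes one value exactly twice and is otherwise injective. -/
def IsPair {m q : ℕ} (v : Fin m → Fin q) : Prop :=
  ∃ i j, i ≠ j ∧ v i = v j ∧ ∀ k l, k ≠ l → v k = v l → (k = i ∧ l = j) ∨ (k = j ∧ l = i)

/-- The word `v` is a constant word changed in exactly one entry. -/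
def IsSpike {m q : ℕ} (v : Fin m → Fin q) : Prop :=
  ∃ a b p, b ≠ a ∧ v = Function.update (fun _ => a) p b

theorem not_isPair_of_three {m q : ℕ} {v : Fin m → Fin q} {i j k : Fin m} (hij : i ≠ j)
    (hik : i ≠ k) (hjk : j ≠ k) (h1 : v i = v j) (h2 : v i = v k) : ¬ IsPair v := by
  rintro ⟨r, s, hrs, -, h⟩
  have := h i j hij h1
  have := h i k hik h2
  have := h j k hjk (h1.symm.trans h2)
  grind

/-- In a spike, any two unequal entries include the altered position, so two such pairs of positions
must meet. -/
theorem not_isSpike_of_disjoint_ne {m q : ℕ} {v : Fin m → Fin q} {i j k l : Fin m} (hik : i ≠ k)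
    (hil : i ≠ l) (hjk : j ≠ k) (hjl : j ≠ l) (h1 : v i ≠ v j) (h2 : v k ≠ v l) :
    ¬ IsSpike v := by
  rintro ⟨a, b, p, hba, rfl⟩
  grind [Function.update_apply]

theorem IsSpike.not_isPair {q : ℕ} (hq : 4 ≤ q) {v : Fin q → Fin q} (h : IsSpike v) :
    ¬ IsPair v := by
  obtain ⟨a, b, p, -, rfl⟩ := h
  obtain ⟨i, hi⟩ := exists_ne_ne (by omega) p p
  obtain ⟨j, hj⟩ := exists_ne_ne (by omega) p i
  obtain ⟨k, hk⟩ := exists_ne_ne_ne hq p i j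
  exact not_isPair_of_three hj.2.symm hk.2.1.symm hk.2.2.symm (by simp [hi, hj]) (by simp [hi, hk])

theorem mem_altRepCode_iff {q : ℕ} {v : Fin q → Fin q} : v ∈ altRepCode q ↔
    (∃ g : Equiv.Perm (Fin q), Equiv.Perm.sign g = 1 ∧ permVertex g = v) ∨
      ∃ a : Fin q, (fun _ => a) = v := by
  simp [altRepCode, permCode, repCode, Equiv.Perm.mem_alternatingGroup]

theorem notMem_altRepCode {q : ℕ} {v : Fin q → Fin q} {i j k l : Fin q} (hij : i ≠ j)
    (h : v i = v j) (h' : v k ≠ v l) : v ∉ altRepCode q := by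
  rw [mem_altRepCode_iff]
  rintro (⟨g, -, rfl⟩ | ⟨a, rfl⟩)
  · exact hij (g.injective h)
  · exact h' rfl

/-- A pair word omits a value `m`. Writing `m` over either of the two equal entries gives two
permutations that differ by the transposition of those positions, so one of them is even. -/
theorem IsPair.exists_adj_even {q : ℕ} {v : Fin q → Fin q} (hv : IsPair v) :
    ∃ g : Equiv.Perm (Fin q), Equiv.Perm.sign g = 1 ∧ (hammingGraph q q).Adj (permVertex g) v := by
  obtain ⟨i, j, hij, hvij, h⟩ := hv
  have hsurj : ¬ Function.Surjective v := fun hs =>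
    hij (Finite.injective_iff_surjective.2 hs hvij)
  obtain ⟨m, hm⟩ : ∃ m, ∀ k, v k ≠ m := by simpa [Function.Surjective] using hsurj
  have hinj : Function.Injective (Function.update v i m) := by
    intro k l hkl
    by_contra hne
    have := h k l hne
    have := hm k
    have := hm l
    grind [Function.update_apply]
  let g : Equiv.Perm (Fin q) := Equiv.ofBijective _ (Finite.injective_iff_bijective.1 hinj)
  have hg : ∀ k, g k = Function.update v i m k := fun _ => rfl
  rcases Int.units_eq_one_or (Equiv.Perm.sign g) with hs | hs
  · exact ⟨g, hs, (adj_update (hm i).symm).symm⟩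
  · refine ⟨g * Equiv.swap i j, by rw [map_mul, hs, Equiv.Perm.sign_swap hij]; rfl, ?_⟩
    have : permVertex (g * Equiv.swap i j) = Function.update v j m := by
      ext1 k
      simp only [permVertex, Equiv.Perm.mul_apply, hg]
      grind [Function.update_apply]
    rw [this]
    exact (adj_update (hm j).symm).symm

theorem mem_neighbourSet_altRepCode {q : ℕ} (hq : 4 ≤ q) {v : Fin q → Fin q} :
    v ∈ neighbourSet (altRepCode q) ↔ IsPair v ∨ IsSpike v := by
  constructor
  · rintro ⟨-, α, hα, hadj⟩
    obtain ⟨i, c, hc, rfl⟩ := adj_iff_exists_update.1 hadj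
    rcases mem_altRepCode_iff.1 hα with ⟨g, -, rfl⟩ | ⟨a, rfl⟩
    · left
      obtain ⟨j, rfl⟩ := g.surjective c
      have hij : i ≠ j := by rintro rfl; exact hc rfl
      refine ⟨i, j, hij, by simp [hij.symm, permVertex], fun k l hkl h => ?_⟩
      have := g.injective.ne hkl
      have hkj : g k = g j → k = j := fun h => g.injective h
      have hlj : g l = g j → l = j := fun h => g.injective h
      simp only [Function.update_apply, permVertex] at h
      grind
    · exact Or.inr ⟨a, c, i, hc, rfl⟩
  · rintro (hv | ⟨a, b, p, hba, rfl⟩)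
    · obtain ⟨g, hg, hadj⟩ := hv.exists_adj_even
      obtain ⟨i, j, hij, hvij, h⟩ := hv
      obtain ⟨k, hk⟩ := exists_ne_ne (by omega) i j
      refine ⟨notMem_altRepCode hij hvij (k := k) (l := i) fun hki => ?_, _,
        mem_altRepCode_iff.2 (Or.inl ⟨g, hg, rfl⟩), hadj⟩
      have := h k i hk.1 hki
      grind
    · obtain ⟨i, hi⟩ := exists_ne_ne (by omega) p p
      obtain ⟨j, hj⟩ := exists_ne_ne (by omega) p i
      exact ⟨notMem_altRepCode hj.2 (k := p) (l := i) (by simp [hi, hj]) (by simpa [hi] using hba),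
        _, mem_altRepCode_iff.2 (Or.inr ⟨a, rfl⟩), adj_update hba⟩

/-! ### The minimum distance -/

theorem hammingDist_permVertex {q : ℕ} (g h : Equiv.Perm (Fin q)) :
    hammingDist (permVertex g) (permVertex h) = (g⁻¹ * h).support.card := by
  unfold hammingDist permVertex
  congr 1
  ext i
  simp only [Finset.mem_filter_univ, Equiv.Perm.mem_support, Equiv.Perm.mul_apply, ne_eq,
    Equiv.Perm.inv_eq_iff_eq]
  rw [eq_comm]

/-- A permutation takes the value `a` only once, so the distance is at least `q - 1`. -/
theorem three_le_hammingDist_const_permVertex {q : ℕ} (hq : 4 ≤ q) (g : Equiv.Perm (Fin q))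
    (a : Fin q) : 3 ≤ hammingDist (fun _ => a) (permVertex g) := by
  have h : (Finset.univ.erase (g⁻¹ a)).card ≤ hammingDist (fun _ => a) (permVertex g) := by
    refine Finset.card_le_card fun i hi => ?_
    rw [Finset.mem_filter]
    refine ⟨Finset.mem_univ _, fun e => (Finset.mem_erase.1 hi).1 ?_⟩
    exact Equiv.Perm.eq_inv_iff_eq.2 e.symm
  rw [Finset.card_erase_of_mem (Finset.mem_univ _), Finset.card_univ, Fintype.card_fin] at h
  omega

theorem hasMinDist_altRepCode {q : ℕ} (hq : 4 ≤ q) : HasMinDist (altRepCode q) 3 := by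
  constructor
  · let a : Fin q := ⟨0, by omega⟩
    let b : Fin q := ⟨1, by omega⟩
    let c : Fin q := ⟨2, by omega⟩
    have h3 : (Equiv.swap a b * Equiv.swap a c).IsThreeCycle :=
      Equiv.Perm.isThreeCycle_swap_mul_swap_same (by simp [a, b]) (by simp [a, c])
        (by simp [b, c])
    have hd := hammingDist_permVertex 1 (Equiv.swap a b * Equiv.swap a c)
    rw [inv_one, one_mul, h3.card_support] at hd
    refine ⟨_, mem_altRepCode_iff.2 (Or.inl ⟨1, map_one _, rfl⟩), _,
      mem_altRepCode_iff.2 (Or.inl ⟨_, h3.sign, rfl⟩), ?_, hd⟩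
    intro h
    rw [h, hammingDist_self] at hd
    omega
  · rintro d ⟨α, hα, β, hβ, hne, rfl⟩
    rcases mem_altRepCode_iff.1 hα with ⟨g, hg, rfl⟩ | ⟨a, rfl⟩ <;>
      rcases mem_altRepCode_iff.1 hβ with ⟨h, hh, rfl⟩ | ⟨b, rfl⟩
    · have hgh : g⁻¹ * h ≠ 1 := fun e => hne (by rw [inv_mul_eq_one.1 e])
      rw [hammingDist_permVertex]
      have h1 : ¬ (g⁻¹ * h).support.card ≤ 1 := fun e => hgh (Equiv.Perm.card_support_le_one.1 e)
      have h2 : (g⁻¹ * h).support.card ≠ 2 := by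
        intro e
        have := (Equiv.Perm.card_support_eq_two.1 e).sign_eq
        rw [map_mul, map_inv, hg, hh] at this
        exact absurd this (by decide)
      omega
    · rw [hammingDist_comm]
      exact three_le_hammingDist_const_permVertex hq g b
    · exact three_le_hammingDist_const_permVertex hq h a
    · have hab : a ≠ b := by rintro rfl; exact hne rfl
      simp only [hammingDist, ne_eq, hab, not_false_eq_true, Finset.filter_true,
        Finset.card_univ, Fintype.card_fin]
      omega

/-! ### The action of the group -/

theorem IsPair.map {m q : ℕ} {v : Fin m → Fin q} (h : IsPair v) {x : HammingAut m q}
    (hx : x ∈ diagTopGroup m q) : IsPair (x v) := by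
  obtain ⟨y, σ, rfl⟩ := (mem_diagTopGroup x).1 hx
  obtain ⟨i, j, hij, hv, h⟩ := h
  have e : ∀ k, (diagHom m q y * topHom m q σ) v k = y (v (σ⁻¹ k)) := fun _ => rfl
  refine ⟨σ i, σ j, σ.injective.ne hij, by simp [e, hv], fun k l hkl hvkl => ?_⟩
  rw [e, e] at hvkl
  simpa only [Equiv.Perm.inv_eq_iff_eq] using
    h (σ⁻¹ k) (σ⁻¹ l) (σ⁻¹.injective.ne hkl) (y.injective hvkl)

theorem IsSpike.map {m q : ℕ} {v : Fin m → Fin q} (h : IsSpike v) {x : HammingAut m q}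
    (hx : x ∈ diagTopGroup m q) : IsSpike (x v) := by
  obtain ⟨y, σ, rfl⟩ := (mem_diagTopGroup x).1 hx
  obtain ⟨a, b, p, hba, rfl⟩ := h
  refine ⟨y a, y b, σ p, y.injective.ne hba, ?_⟩
  ext1 k
  change y (Function.update (fun _ => a) p b (σ⁻¹ k)) = _
  by_cases hk : k = σ p
  · simp [hk]
  · rw [Function.update_of_ne hk,
      Function.update_of_ne fun e => hk (Equiv.Perm.inv_eq_iff_eq.1 e)]

theorem mapsTo_neighbourSet {q : ℕ} (hq : 4 ≤ q) {x : HammingAut q q}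
    (hx : x ∈ diagTopGroup q q) {v : Fin q → Fin q} (hv : v ∈ neighbourSet (altRepCode q)) :
    x v ∈ neighbourSet (altRepCode q) := by
  rw [mem_neighbourSet_altRepCode hq] at hv ⊢
  exact hv.imp (·.map hx) (·.map hx)

theorem diagTopGroup_le_stabilizer {q : ℕ} (hq : 4 ≤ q) :
    diagTopGroup q q ≤ MulAction.stabilizer (HammingAut q q) (neighbourSet (altRepCode q)) := by
  intro x hx
  rw [MulAction.mem_stabilizer_iff]
  refine Set.Subset.antisymm ?_ fun v hv => ?_
  · rintro _ ⟨v, hv, rfl⟩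
    exact mapsTo_neighbourSet hq hx hv
  · rw [Set.mem_smul_set_iff_inv_smul_mem]
    exact mapsTo_neighbourSet hq (inv_mem hx) hv

theorem isElusivePair_altRepCode {q : ℕ} (hq : 4 ≤ q) :
    IsElusivePair 3 (altRepCode q) (diagTopGroup q q) := by
  refine ⟨hasMinDist_altRepCode hq,
    fun x hx => MulAction.mem_stabilizer_iff.1 (diagTopGroup_le_stabilizer hq hx), fun h => ?_⟩
  let a : Fin q := ⟨0, by omega⟩
  let b : Fin q := ⟨1, by omega⟩
  have hab : a ≠ b := by simp [a, b]
  have hx : diagHom q q (Equiv.swap a b) ∈ diagTopGroup q q :=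
    Subgroup.mem_sup_left ⟨_, rfl⟩
  have hmem : permVertex (Equiv.swap a b) ∈ altRepCode q := by
    rw [← h _ hx]
    exact ⟨permVertex 1, mem_altRepCode_iff.2 (Or.inl ⟨1, map_one _, rfl⟩), rfl⟩
  rcases mem_altRepCode_iff.1 hmem with ⟨g, hg, hgv⟩ | ⟨c, hc⟩
  · have : g = Equiv.swap a b := Equiv.ext fun i => congrFun hgv i
    rw [this, Equiv.Perm.sign_swap hab] at hg
    exact absurd hg (by decide)
  · have h1 := congrFun hc a
    have h2 := congrFun hc b
    exact hab ((Equiv.swap a b).injective (h1.symm.trans h2))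

theorem not_transitiveOn_altRepCode {q : ℕ} (hq : 4 ≤ q) :
    ¬ TransitiveOn (diagTopGroup q q) (neighbourSet (altRepCode q)) := by
  intro h
  let a : Fin q := ⟨0, by omega⟩
  let b : Fin q := ⟨1, by omega⟩
  have hab : a ≠ b := by simp [a, b]
  have hs : IsSpike (Function.update (fun _ : Fin q => a) a b) := ⟨a, b, a, hab.symm, rfl⟩
  have hp : IsPair (Function.update (id : Fin q → Fin q) a b) := by
    refine ⟨a, b, hab, by simp [hab.symm], fun k l hkl h => ?_⟩
    simp only [Function.update_apply, id] at h
    grind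
  obtain ⟨x, hx, hxv⟩ := h _ ((mem_neighbourSet_altRepCode hq).2 (Or.inr hs)) _
    ((mem_neighbourSet_altRepCode hq).2 (Or.inl hp))
  have hs' := hs.map hx
  rw [show x _ = _ from hxv] at hs'
  exact hs'.not_isPair hq hp

/-! ### Automorphisms fixing the repetition code pointwise -/

/-- A metric test for a single entry of `v`, which automorphisms can therefore transport. -/
theorem hammingDist_update_const_eq_iff {m q : ℕ} {v : Fin m → Fin q} {a b : Fin q} (hba : b ≠ a)
    (i : Fin m) : hammingDist v (Function.update (fun _ => a) i b) =
      hammingDist v (fun _ => a) + 1 ↔ v i = a := by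
  constructor
  · intro h
    by_contra hv
    have := hammingDist_update_le_of_ne (v := v) (w := fun _ => a) (b := b) hv
    omega
  · rintro rfl
    exact hammingDist_update_of_eq rfl hba

theorem exists_position_map {m q : ℕ} (hq : 2 ≤ q) {x : HammingAut m q}
    (hx : ∀ a, x (fun _ => a) = fun _ => a) (a : Fin q) (i : Fin m) :
    ∃ j, ∀ v, x v j = a ↔ v i = a := by
  have : Nontrivial (Fin q) := Fin.nontrivial_iff_two_le.2 hq
  obtain ⟨b, hba⟩ := exists_ne a
  have hadj : (hammingGraph m q).Adj (x fun _ => a) (x (Function.update (fun _ => a) i b)) :=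
    x.map_rel_iff.2 (adj_update hba)
  rw [hx, adj_iff_exists_update] at hadj
  obtain ⟨j, c, hca, hj⟩ := hadj
  refine ⟨j, fun v => ?_⟩
  rw [← hammingDist_update_const_eq_iff hba i, ← hammingDist_update_const_eq_iff hca j, ← hj,
    hammingDist_map]
  have h := hammingDist_map x v fun _ => a
  rw [hx] at h
  rw [h]

theorem mem_topGroup_of_fixes_const {m q : ℕ} (hq : 2 ≤ q) {x : HammingAut m q}
    (hx : ∀ a, x (fun _ => a) = fun _ => a) : x ∈ topGroup m q := by
  have : Nontrivial (Fin q) := Fin.nontrivial_iff_two_le.2 hq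
  choose π hπ using exists_position_map hq hx
  have hinj : ∀ a, Function.Injective (π a) := by
    intro a i j hij
    obtain ⟨b, hba⟩ := exists_ne a
    have h1 := hπ a i (Function.update (fun _ => b) i a)
    rw [hij, hπ] at h1
    by_contra hne
    simp [Ne.symm hne, hba] at h1
  have hsurj : ∀ a, Function.Surjective (π a) := fun a =>
    Finite.injective_iff_surjective.1 (hinj a)
  have heq : ∀ a b i, a ≠ b → π a i = π b i := by
    intro a b i hab
    -- The test word is `b` everywhere except for `a` at `i`. If `k ≠ i`, its image would have both
    -- `a` and `b` at position `π a i = π b k`.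
    obtain ⟨k, hk⟩ := hsurj b (π a i)
    have h1 := (hπ a i (Function.update (fun _ => b) i a)).2 (by simp)
    by_cases hki : k = i
    · rw [← hk, hki]
    · have h2 := (hπ b k (Function.update (fun _ => b) i a)).2 (by simp [hki])
      rw [hk, h1] at h2
      exact absurd h2 hab
  let a₀ : Fin q := ⟨0, by omega⟩
  have heq' : ∀ a i, π a i = π a₀ i := fun a i => by
    by_cases h : a = a₀
    · rw [h]
    · exact heq a a₀ i h
  let σ : Equiv.Perm (Fin m) := Equiv.ofBijective (π a₀) ⟨hinj a₀, hsurj a₀⟩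
  refine ⟨σ, RelIso.ext fun v => funext fun k => ?_⟩
  obtain ⟨i, rfl⟩ := σ.surjective k
  rw [topHom_apply, show σ⁻¹ (σ i) = i from σ.symm_apply_apply i, show σ i = π (v i) i from (heq' _ _).symm,
    (hπ (v i) i v).2 rfl]

/-! ### The full stabiliser -/

/-- Overwriting either of the two equal entries with a value already used at a third position `r`
moves the coincidence; the two results differ at both `i` and `j`. -/
theorem IsPair.exists_neighbours {q : ℕ} (hq : 4 ≤ q) {w : Fin q → Fin q} (h : IsPair w) :
    ∃ u u', IsPair u ∧ IsPair u' ∧ (hammingGraph q q).Adj w u ∧ (hammingGraph q q).Adj w u' ∧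
      u ≠ u' ∧ ¬ (hammingGraph q q).Adj u u' := by
  obtain ⟨i, j, hij, hwij, h⟩ := h
  obtain ⟨r, hri, hrj⟩ := exists_ne_ne (by omega) i j
  have hr : w r ≠ w i := fun e => by have := h r i hri e; grind
  have hr' : w r ≠ w j := fun e => hr (e.trans hwij.symm)
  refine ⟨Function.update w i (w r), Function.update w j (w r), ⟨i, r, hri.symm, by simp [hri], ?_⟩,
    ⟨j, r, hrj.symm, by simp [hrj], ?_⟩, adj_update hr, adj_update hr', ?_, ?_⟩
  · intro k l hkl e
    have := h k l hkl
    have := h r k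
    have := h r l
    simp only [Function.update_apply] at e
    grind
  · intro k l hkl e
    have := h k l hkl
    have := h r k
    have := h r l
    simp only [Function.update_apply] at e
    grind
  · intro e
    have := congrFun e i
    simp [hij, hr] at this
  · exact not_adj_of_ne_of_ne hij (by simpa [hij] using hr) (by simpa [hij.symm] using hr'.symm)

/-- Changing an entry other than `p` leaves `q - 2 ≥ 3` entries equal to `a`, too many for a pair
word, and two entries different from `a`, too many for a spike. For `q = 4` a pair word can arise.
-/
theorem IsSpike.neighbour_eq {q : ℕ} (hq : 5 ≤ q) {a b p : Fin q} (hba : b ≠ a)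
    {u : Fin q → Fin q} (hadj : (hammingGraph q q).Adj (Function.update (fun _ => a) p b) u)
    (hu : IsPair u ∨ IsSpike u) : ∃ c, u = Function.update (fun _ => a) p c := by
  obtain ⟨i, c, hc, rfl⟩ := adj_iff_exists_update.1 hadj
  by_cases hip : i = p
  · subst hip
    exact ⟨c, by simp⟩
  exfalso
  rw [Function.update_of_ne hip] at hc
  obtain ⟨k, hki, hkp⟩ := exists_ne_ne (by omega) i p
  obtain ⟨l, hli, hlp, hlk⟩ := exists_ne_ne_ne (by omega) i p k
  obtain ⟨r, hri, hrp, hrk, hrl⟩ := exists_ne_ne_ne_ne hq i p k l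
  rcases hu with hu | hu
  · exact not_isPair_of_three hlk.symm hrk.symm hrl.symm (by simp [*]) (by simp [*]) hu
  · exact not_isSpike_of_disjoint_ne (i := i) (j := k) (k := p) (l := l) hip hli.symm hkp
      hlk.symm (by simp [*]) (by simp [Ne.symm hip, *]) hu

/-- The neighbours of a spike within `Γ₁(C)` vary only at its altered position, hence form a clique;
those of a pair word do not. The criterion mentions only adjacency and `Γ₁(C)`, so the stabiliser
respects it. -/
theorem isSpike_iff {q : ℕ} (hq : 5 ≤ q) {w : Fin q → Fin q} :
    IsSpike w ↔ w ∈ neighbourSet (altRepCode q) ∧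
      ∀ u ∈ neighbourSet (altRepCode q), ∀ u' ∈ neighbourSet (altRepCode q),
        (hammingGraph q q).Adj w u → (hammingGraph q q).Adj w u' →
          u = u' ∨ (hammingGraph q q).Adj u u' := by
  have hq4 : 4 ≤ q := by omega
  simp only [mem_neighbourSet_altRepCode hq4]
  constructor
  · intro h
    refine ⟨Or.inr h, fun u hu u' hu' hadj hadj' => ?_⟩
    obtain ⟨a, b, p, hba, rfl⟩ := h
    obtain ⟨c, rfl⟩ := IsSpike.neighbour_eq hq hba hadj hu
    obtain ⟨d, rfl⟩ := IsSpike.neighbour_eq hq hba hadj' hu'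
    by_cases hdc : d = c
    · rw [hdc]; exact Or.inl rfl
    · exact Or.inr (adj_iff_exists_update.2 ⟨p, d, by simpa using hdc, by simp⟩)
  · rintro ⟨h | h, h'⟩
    · obtain ⟨u, u', hu, hu', hadj, hadj', hne, hna⟩ := h.exists_neighbours hq4
      exact ((h' u (Or.inl hu) u' (Or.inl hu') hadj hadj').elim hne hna).elim
    · exact h

theorem exists_eq_const_of_neighbours_isSpike {q : ℕ} (hq : 4 ≤ q) {v : Fin q → Fin q}
    (h : ∀ u, (hammingGraph q q).Adj v u → IsSpike u) : ∃ a, v = fun _ => a := by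
  by_contra! hv
  obtain ⟨j, hj⟩ := Function.ne_iff.1 (hv (v ⟨0, by omega⟩))
  set i : Fin q := ⟨0, by omega⟩
  obtain ⟨k, hki, hkj⟩ := exists_ne_ne (by omega) i j
  obtain ⟨l, hli, hlj, hlk⟩ := exists_ne_ne_ne (by omega) i j k
  -- Away from the unequal entries `i` and `j`, entry `k` is changed to differ from entry `l`: two
  -- disjoint unequal pairs rule out a spike.
  obtain ⟨c, hck, hcl⟩ := exists_ne_ne (by omega) (v k) (v l)
  exact not_isSpike_of_disjoint_ne (i := j) (j := i) (k := k) (l := l) hkj.symm hlj.symm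
    hki.symm hli.symm (by simpa [hki.symm, hkj.symm] using hj) (by simpa [hlk] using hcl)
    (h _ (adj_update hck))

theorem apply_mem_of_mem_stabilizer {m q : ℕ} {S : Set (Fin m → Fin q)} {x : HammingAut m q}
    (hx : x ∈ MulAction.stabilizer (HammingAut m q) S) {v : Fin m → Fin q} (hv : v ∈ S) :
    x v ∈ S := by
  rw [← MulAction.mem_stabilizer_iff.1 hx]
  exact ⟨v, hv, rfl⟩

theorem IsSpike.map_stabilizer {q : ℕ} (hq : 5 ≤ q) {x : HammingAut q q}
    (hx : x ∈ MulAction.stabilizer (HammingAut q q) (neighbourSet (altRepCode q)))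
    {w : Fin q → Fin q} (h : IsSpike w) : IsSpike (x w) := by
  rw [isSpike_iff hq] at h ⊢
  refine ⟨apply_mem_of_mem_stabilizer hx h.1, fun u hu u' hu' hadj hadj' => ?_⟩
  have key : ∀ u, x (x⁻¹ u) = u := fun u => x.apply_symm_apply u
  have hi : ∀ u ∈ neighbourSet (altRepCode q), x⁻¹ u ∈ neighbourSet (altRepCode q) :=
    fun u hu => apply_mem_of_mem_stabilizer (inv_mem hx) hu
  rw [← key u] at hadj ⊢
  rw [← key u'] at hadj' ⊢
  exact (h.2 _ (hi u hu) _ (hi u' hu') (x.map_rel_iff.1 hadj) (x.map_rel_iff.1 hadj')).imp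
    (congrArg x) x.map_rel_iff.2

theorem exists_map_const_eq {q : ℕ} (hq : 5 ≤ q) {x : HammingAut q q}
    (hx : x ∈ MulAction.stabilizer (HammingAut q q) (neighbourSet (altRepCode q))) (a : Fin q) :
    ∃ b, x (fun _ => a) = fun _ => b := by
  refine exists_eq_const_of_neighbours_isSpike (by omega) fun u hu => ?_
  have key : x (x⁻¹ u) = u := x.apply_symm_apply u
  rw [← key] at hu ⊢
  obtain ⟨i, c, hc, e⟩ := adj_iff_exists_update.1 (x.map_rel_iff.1 hu)
  exact IsSpike.map_stabilizer hq hx ⟨a, c, i, hc, e⟩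

theorem stabilizer_le_diagTopGroup {q : ℕ} (hq : 5 ≤ q) :
    MulAction.stabilizer (HammingAut q q) (neighbourSet (altRepCode q)) ≤ diagTopGroup q q := by
  intro x hx
  choose f hf using exists_map_const_eq hq hx
  have hinj : Function.Injective f := by
    intro a b hab
    have h : x (fun _ => a) = x (fun _ => b) := by rw [hf, hf, hab]
    exact congrFun (x.injective h) ⟨0, by omega⟩
  let y : Equiv.Perm (Fin q) := Equiv.ofBijective f (Finite.injective_iff_bijective.1 hinj)
  have htop : (diagHom q q y)⁻¹ * x ∈ topGroup q q := by
    refine mem_topGroup_of_fixes_const (by omega) fun a => ?_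
    rw [← map_inv]
    change diagHom q q y⁻¹ (x fun _ => a) = _
    rw [hf]
    ext1 i
    rw [diagHom_apply]
    exact Equiv.Perm.inv_eq_iff_eq.2 rfl
  rw [← mul_inv_cancel_left (diagHom q q y) x]
  exact mul_mem (Subgroup.mem_sup_left ⟨y, rfl⟩) (Subgroup.mem_sup_right htop)

end ElusiveCode

theorem mainTheorem5 (q : ℕ) (hq : 4 ≤ q) :
    ElusiveCode.IsElusivePair 3 (ElusiveCode.altRepCode q) (ElusiveCode.diagTopGroup q q) ∧
      ¬ ElusiveCode.TransitiveOn (ElusiveCode.diagTopGroup q q)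
        (ElusiveCode.neighbourSet (ElusiveCode.altRepCode q)) ∧
      (5 ≤ q → ElusiveCode.diagTopGroup q q =
        MulAction.stabilizer (ElusiveCode.HammingAut q q)
          (ElusiveCode.neighbourSet (ElusiveCode.altRepCode q))) :=
  ⟨ElusiveCode.isElusivePair_altRepCode hq, ElusiveCode.not_transitiveOn_altRepCode hq, fun hq5 =>
    le_antisymm (ElusiveCode.diagTopGroup_le_stabilizer hq)
      (ElusiveCode.stabilizer_le_diagTopGroup hq5)⟩
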